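/- For Heyting algebras $B$, $C$ let $B + C$ denote their concatenation: $C$ is put on top of $B$, and the top element of $B$ is glued to the bottom element of $C$; here $B\times C + D$ means $(B\times C)+D$. Let $Z$ be the Rieger–Nishimura ladder (the free Heyting algebra on one generator $g$), let $Z_2=\{0,1\}$ be the two-element Boolean algebra, and let $Z' = Z\times Z_2 + Z_2$. For a class $V$ of Heyting algebras, a formula $\varphi(p_1,\dots,p_n)$ in the connectives $\wedge,\vee,\to,\neg$ and elements $a_1,\dots,a_n$ of a Heyting algebra $B$ are said to define $B$ over $V$ if (1) $a_1,\dots,a_n$ generate $B$, (2) $\varphi(a_1,\dots,a_n)=1$ in $B$, and (3) for every formula $\psi(p_1,\dots,p_n)$ with $\psi(a_1,\dots,a_n)=1$ in $B$, the formula $\varphi\to\psi$ is valid in every algebra of $V$. The algebra $B$ is finitely presentable over $V$ if some formula and some finite tuple of elements define it over $V$. **Theorem.** Let $A$ be any non-degenerate Heyting algebra and let $V$ be the variety generated by $Z\times Z_2 + A$. The algebra $Z'$ is infinite and subdirectly irreducible, it belongs to $V$, and it is finitely presentable over $V$. More precisely, the formula $$\neg(p\wedge q)\wedge(\neg\neg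 q\to q)\wedge\bigl(p^{10}\to(q\vee\neg q)\bigr),\qquad p^{10}=(\neg\neg p\to p)\vee\bigl((\neg\neg p\to p)\to(p\vee\neg p)\bigr),$$ together with the valuation $p\mapsto (g,0)$, $q\mapsto(0,1)$ in $Z\times Z_2\subseteq Z'$, defines $Z'$ over $V$. -/

import Mathlib

universe u v

/-! ### Propositional formulas and their values in Heyting algebras -/

/-- Propositional formulas in the signature `∧, ∨, →, ¬` over a set `σ` of variables. -/
inductive Formula (σ : Type) : Type
  | var : σ → Formula σ
  | and : Formula σ → Formula σ → Formula σ
  | or : Formula σ → Formula σ → Formula σ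
  | imp : Formula σ → Formula σ → Formula σ
  | neg : Formula σ → Formula σ

/-- The value of a formula under a valuation of its variables. -/
def Formula.eval {σ : Type} {A : Type u} [HeytingAlgebra A] (ν : σ → A) : Formula σ → A
  | .var i => ν i
  | .and φ ψ => φ.eval ν ⊓ ψ.eval ν
  | .or φ ψ => φ.eval ν ⊔ ψ.eval ν
  | .imp φ ψ => φ.eval ν ⇨ ψ.eval ν
  | .neg φ => (φ.eval ν)ᶜ

/-! ### Varieties -/

/-- A class of Heyting algebras (with carriers in a fixed universe). -/
abbrev HeytingClass : Type (u + 1) := ∀ (A : Type u) [HeytingAlgebra A], Prop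

/-- A variety: a class closed under homomorphic images, (isomorphic copies of) subalgebras and
direct products. -/
structure IsVariety (K : HeytingClass.{u}) : Prop where
  homImage : ∀ (A B : Type u) [HeytingAlgebra A] [HeytingAlgebra B] (f : HeytingHom A B),
    Function.Surjective f → K A → K B
  subalgebra : ∀ (A B : Type u) [HeytingAlgebra A] [HeytingAlgebra B] (f : HeytingHom B A),
    Function.Injective f → K A → K B
  product : ∀ (I : Type u) (A : I → Type u) [∀ i, HeytingAlgebra (A i)],
    (∀ i, K (A i)) → K (∀ i, A i)

/-- The variety generated by `A`: the smallest variety that contains `A`. -/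
def generatedVariety (A : Type u) [HeytingAlgebra A] : HeytingClass.{u} :=
  fun B _ => ∀ K : HeytingClass.{u}, IsVariety K → K A → K B

/-- The formula `φ` is valid in every algebra of the class `K`. -/
def ValidIn {σ : Type} (K : HeytingClass.{u}) (φ : Formula σ) : Prop :=
  ∀ (C : Type u) [HeytingAlgebra C], K C → ∀ μ : σ → C, φ.eval μ = ⊤

/-! ### Finite presentability -/

/-- The elements `ν i` generate `A`: the only subset that contains them and is closed under the
operations is `A` itself. -/
def Generates {σ : Type} {A : Type u} [HeytingAlgebra A] (ν : σ → A) : Prop :=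
  ∀ S : Set A, (∀ i, ν i ∈ S) →
    (∀ x ∈ S, ∀ y ∈ S, x ⊓ y ∈ S) → (∀ x ∈ S, ∀ y ∈ S, x ⊔ y ∈ S) →
    (∀ x ∈ S, ∀ y ∈ S, x ⇨ y ∈ S) → (∀ x ∈ S, xᶜ ∈ S) → S = Set.univ

/-- The formula `φ` and the valuation `ν` define the algebra `A` over the class `K`. -/
structure DefinesOver {n : ℕ} (K : HeytingClass.{u}) {A : Type v} [HeytingAlgebra A]
    (φ : Formula (Fin n)) (ν : Fin n → A) : Prop where
  generates : Generates ν
  holds : φ.eval ν = ⊤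
  consequence : ∀ ψ : Formula (Fin n), ψ.eval ν = ⊤ → ValidIn K (.imp φ ψ)

/-- The algebra `A` is finitely presentable over the class `K`. -/
def FinitelyPresentableOver (K : HeytingClass.{u}) (A : Type v) [HeytingAlgebra A] : Prop :=
  ∃ (n : ℕ) (φ : Formula (Fin n)) (ν : Fin n → A), DefinesOver K φ ν

/-- The class `K` contains an isomorphic copy of `A`. (An order isomorphism of Heyting algebras
preserves all the operations; the copy only serves to move `A` to the universe of `K`.) -/
def ContainsCopy (K : HeytingClass.{u}) (A : Type v) [HeytingAlgebra A] : Prop :=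
  ∃ (C : Type u) (_ : HeytingAlgebra C), K C ∧ Nonempty (A ≃o C)

/-! ### Subdirect irreducibility -/

/-- Congruences of a Heyting algebra. -/
structure IsHeytingCongruence {A : Type u} [HeytingAlgebra A] (r : Setoid A) : Prop where
  inf : ∀ a b c d, r a b → r c d → r (a ⊓ c) (b ⊓ d)
  sup : ∀ a b c d, r a b → r c d → r (a ⊔ c) (b ⊔ d)
  himp : ∀ a b c d, r a b → r c d → r (a ⇨ c) (b ⇨ d)
  compl : ∀ a b, r a b → r aᶜ bᶜ

/-- `A` is subdirectly irreducible: it is non-degenerate, and among its congruences other than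
equality there is a least one. -/
def SubdirectlyIrreducible (A : Type u) [HeytingAlgebra A] : Prop :=
  Nontrivial A ∧ ∃ r : Setoid A, IsHeytingCongruence r ∧ r ≠ ⊥ ∧
    ∀ s : Setoid A, IsHeytingCongruence s → s ≠ ⊥ → r ≤ s

/-! ### The Rieger–Nishimura ladder -/

/-- The points `w₀, w₁, w₂, …` of the Rieger–Nishimura frame. -/
@[ext] structure RNPoint : Type where
  idx : ℕ

/-- `wₘ ≤ wₙ` (in the frame: `wₙ` sees `wₘ`) if and only if `m = n` or `m + 2 ≤ n`. So `w₀` and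
`w₁` see only themselves, `w₂` sees `w₀`, `w₃` sees `w₀, w₁`, `w₄` sees `w₀, w₁, w₂`, etc. -/
instance : PartialOrder RNPoint where
  le w w' := w.idx = w'.idx ∨ w.idx + 2 ≤ w'.idx
  le_refl w := Or.inl rfl
  le_trans a b c := by intro h h'; omega
  le_antisymm a b h h' := by
    apply RNPoint.ext; omega

/-- The Rieger–Nishimura ladder, as the Heyting algebra of all sets of points of the
Rieger–Nishimura frame that are closed under the relation `sees`. They are
`∅, {w₀}, {w₁}, {w₀, w₁}, {w₀, w₂}, {w₀, w₁, w₂}, {w₀, w₁, w₃}, …` and the whole frame. -/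
abbrev RNLadder : Type := LowerSet RNPoint

/-- The free generator `g = {w₀}` of the Rieger–Nishimura ladder. -/
def RNLadder.gen : RNLadder := LowerSet.Iic ⟨0⟩

/-! ### Concatenation -/

/-- The concatenation `A + B`: the algebra `B` is put onto `A`, and the top of `A` is glued to the
bottom of `B`. An element `a` of `A` is represented by the pair `(a, ⊥)`, an element `b` of `B` by
the pair `(⊤, b)`; the glued element is `(⊤, ⊥)`. -/
@[ext] structure Concat (A : Type u) (B : Type v) [HeytingAlgebra A] [HeytingAlgebra B] :
    Type (max u v) where
  fst : A
  snd : B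
  glued : fst = ⊤ ∨ snd = ⊥

namespace Concat

variable {A : Type u} {B : Type v} [HeytingAlgebra A] [HeytingAlgebra B]

/-- The copy of `A` in `A + B`. -/
def inl (a : A) : Concat A B := ⟨a, ⊥, Or.inr rfl⟩

/-- The copy of `B` in `A + B`. -/
def inr (b : B) : Concat A B := ⟨⊤, b, Or.inl rfl⟩

/-- Each copy has its own order, and every element of `A` is below every element of `B`. -/
instance : PartialOrder (Concat A B) where
  le x y := x.fst ≤ y.fst ∧ x.snd ≤ y.snd
  le_refl x := ⟨le_rfl, le_rfl⟩
  le_trans x y z h h' := ⟨h.1.trans h'.1, h.2.trans h'.2⟩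
  le_antisymm x y h h' := Concat.ext (h.1.antisymm h'.1) (h.2.antisymm h'.2)

instance : DistribLattice (Concat A B) where
  sup x y := ⟨x.fst ⊔ y.fst, x.snd ⊔ y.snd, by
    rcases x.glued with h | h <;> rcases y.glued with h' | h' <;> simp [h, h']⟩
  le_sup_left x y := ⟨le_sup_left, le_sup_left⟩
  le_sup_right x y := ⟨le_sup_right, le_sup_right⟩
  sup_le x y z h h' := ⟨sup_le h.1 h'.1, sup_le h.2 h'.2⟩
  inf x y := ⟨x.fst ⊓ y.fst, x.snd ⊓ y.snd, by
    rcases x.glued with h | h <;> rcases y.glued with h' | h' <;> simp [h, h']⟩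
  inf_le_left x y := ⟨inf_le_left, inf_le_left⟩
  inf_le_right x y := ⟨inf_le_right, inf_le_right⟩
  le_inf x y z h h' := ⟨le_inf h.1 h'.1, le_inf h.2 h'.2⟩
  le_sup_inf x y z := ⟨le_sup_inf, le_sup_inf⟩

instance : BoundedOrder (Concat A B) where
  top := ⟨⊤, ⊤, Or.inl rfl⟩
  le_top _ := ⟨le_top, le_top⟩
  bot := ⟨⊥, ⊥, Or.inr rfl⟩
  bot_le _ := ⟨bot_le, bot_le⟩

open Classical in
/-- The Heyting implication of `A + B`. -/
noncomputable def himp (x y : Concat A B) : Concat A B where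
  fst := x.fst ⇨ y.fst
  snd := if x.fst ≤ y.fst then x.snd ⇨ y.snd else ⊥
  glued := by
    by_cases h : x.fst ≤ y.fst
    · exact Or.inl (himp_eq_top_iff.2 h)
    · exact Or.inr (if_neg h)

open Classical in
theorem le_himp (x y z : Concat A B) : x ≤ himp y z ↔ x ⊓ y ≤ z := by
  change (x.fst ≤ y.fst ⇨ z.fst ∧ x.snd ≤ if y.fst ≤ z.fst then _ else _) ↔
    (x.fst ⊓ y.fst ≤ z.fst ∧ x.snd ⊓ y.snd ≤ z.snd)
  by_cases h : y.fst ≤ z.fst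
  · rw [if_pos h, le_himp_iff, le_himp_iff]
  · rw [if_neg h, le_himp_iff]
    refine and_congr_right fun h1 => ⟨fun h2 => (inf_le_left.trans h2).trans bot_le, fun _ => ?_⟩
    rcases x.glued with hx | hx
    · rw [hx, top_inf_eq] at h1
      exact absurd h1 h
    · exact hx.le

noncomputable instance : HeytingAlgebra (Concat A B) :=
  HeytingAlgebra.ofHImp himp le_himp

end Concat

/-! ### The algebra `Z' = Z × Z₂ + Z₂` and its presentation -/

/-- The algebra `Z' = Z × Z₂ + Z₂`, where `Z` is the Rieger–Nishimura ladder. -/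
abbrev ZPrime : Type := Concat (RNLadder × Bool) Bool

/-- The element `(g, 0)` of `Z'`. -/
noncomputable def ZPrime.a : ZPrime := Concat.inl (RNLadder.gen, false)

/-- The element `(0, 1)` of `Z'`. -/
noncomputable def ZPrime.b : ZPrime := Concat.inl (⊥, true)

/-- For a formula `p`, the formula `p¹⁰ = (¬¬p → p) ∨ ((¬¬p → p) → (p ∨ ¬p))`. -/
def Formula.pow10 {σ : Type} (p : Formula σ) : Formula σ :=
  .or (.imp (.neg (.neg p)) p) (.imp (.imp (.neg (.neg p)) p) (.or p (.neg p)))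

/-- The formula `¬(p ∧ q) ∧ (¬¬q → q) ∧ (p¹⁰ → (q ∨ ¬q))` in the variables `p = p₀`, `q = p₁`. -/
def definingFormula : Formula (Fin 2) :=
  let p : Formula (Fin 2) := .var 0
  let q : Formula (Fin 2) := .var 1
  .and (.neg (.and p q))
    (.and (.imp (.neg (.neg q)) q) (.imp p.pow10 (.or q (.neg q))))

/-! ### Evaluation of formulas -/

/-! A formula valid in Z × Z₂ + A is valid in the whole variety, so the task is to show e ≤ ψ(p, q)
for all p, q in Z × Z₂ + A, where e is the value of the defining formula and ψ(a, b) = 1 in Z'.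

Suppose e ≤ q ∨ ¬q. Then e splits into e ∧ q and e ∧ ¬q (`definingFormula_le_of_le`). Below e ∧ q, p
equals 0 and q equals 1, and ψ(0, 1) = 1 because Z' projects onto Z₂ with a ↦ 0, b ↦ 1. Below e ∧
¬q, q equals 0, and ψ(p, 0) = 1 because Z' projects onto Z with a ↦ g, b ↦ 0, and Z is free on g
(`Formula.eval_eq_top_of_gen`).

In the other case p and q are forced to be (g, 0) and (0, 1) (`definingFormula_le_or_eq`), and Z'
maps to Z × Z₂ + A with these as the images of a and b. The point is that e ≤ q ∨ ¬q always holds in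
Z and in Z₂, so it can fail in the concatenation only if e lies in the upper part. The disjunction
property of Z then makes the Z-coordinate of q equal to 0 or 1, and g is the only element of Z with
g¹⁰ ≠ 1.

Freeness is proved by duality: the prime ideals of a Heyting algebra are the points of a Kripke
frame (z holds at J when z ∉ J), which maps to the Rieger–Nishimura frame with a point at infinity
added.

For non-degenerate A the map from Z' is injective, which puts Z' into the variety. -/

theorem Formula.eval_map {σ : Type} {A : Type u} {B : Type v} [HeytingAlgebra A]
    [HeytingAlgebra B] (f : HeytingHom A B) (ν : σ → A) (χ : Formula σ) :
    χ.eval (fun i => f (ν i)) = f (χ.eval ν) := by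
  induction χ <;> simp_all [Formula.eval]

theorem Formula.eval_map_pair {A : Type u} {B : Type v} [HeytingAlgebra A]
    [HeytingAlgebra B] (f : HeytingHom A B) (x y : A) (χ : Formula (Fin 2)) :
    χ.eval ![f x, f y] = f (χ.eval ![x, y]) := by
  rw [← χ.eval_map f]
  congr 1
  funext i
  fin_cases i <;> rfl

/-- The value of a formula below `c` depends only on the values of the variables below `c`. -/
theorem Formula.inf_eval_congr {σ : Type} {A : Type u} [HeytingAlgebra A] {c : A} {ν μ : σ → A}
    (h : ∀ i, c ⊓ ν i = c ⊓ μ i) (χ : Formula σ) : c ⊓ χ.eval ν = c ⊓ χ.eval μ := by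
  have key : ∀ x y x' y' : A, c ⊓ x = c ⊓ x' → c ⊓ y = c ⊓ y' → c ⊓ (x ⇨ y) ≤ x' ⇨ y' := by
    intro x y x' y' hx hy
    rw [le_himp_iff]
    calc c ⊓ (x ⇨ y) ⊓ x' = (c ⊓ x') ⊓ (x ⇨ y) := by ac_rfl
      _ = c ⊓ (x ⊓ (x ⇨ y)) := by rw [← hx, inf_assoc]
      _ ≤ c ⊓ y := inf_le_inf_left c inf_himp_le
      _ ≤ y' := hy ▸ inf_le_right
  have himp : ∀ x y x' y' : A, c ⊓ x = c ⊓ x' → c ⊓ y = c ⊓ y' →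
      c ⊓ (x ⇨ y) = c ⊓ (x' ⇨ y') := fun x y x' y' hx hy =>
    le_antisymm (le_inf inf_le_left (key _ _ _ _ hx hy))
      (le_inf inf_le_left (key _ _ _ _ hx.symm hy.symm))
  induction χ with
  | var i => exact h i
  | and φ ψ hφ hψ =>
    simp only [Formula.eval]
    rw [inf_inf_distrib_left, hφ, hψ, ← inf_inf_distrib_left]
  | or φ ψ hφ hψ => simp only [Formula.eval]; rw [inf_sup_left, hφ, hψ, ← inf_sup_left]
  | imp φ ψ hφ hψ => exact himp _ _ _ _ hφ hψ
  | neg φ hφ =>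
    simp only [Formula.eval, ← himp_bot]
    exact himp _ _ _ _ hφ rfl

/-- The algebras in which a formula is valid form a variety. -/
theorem isVariety_valid {σ : Type} (χ : Formula σ) :
    IsVariety.{u} (fun A _ => ∀ μ : σ → A, χ.eval μ = ⊤) where
  homImage A B _ _ f hf h μ := by
    choose g hg using hf
    have := χ.eval_map f (fun i => g (μ i))
    simpa [hg, h] using this
  subalgebra A B _ _ f hf h μ := by
    apply hf
    rw [← χ.eval_map f, h, map_top]
  product I A _ h μ := by
    funext i
    let f : HeytingHom (∀ i, A i) (A i) :=
      { toFun := fun x => x i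
        map_sup' := fun _ _ => rfl
        map_inf' := fun _ _ => rfl
        map_bot' := rfl
        map_himp' := fun _ _ => rfl }
    exact (χ.eval_map f μ).symm.trans (h i _)

theorem validIn_generatedVariety {σ : Type} {A : Type u} [HeytingAlgebra A] {χ : Formula σ}
    (h : ∀ μ : σ → A, χ.eval μ = ⊤) : ValidIn (generatedVariety A) χ :=
  fun _ _ hC => hC _ (isVariety_valid χ) h

/-! ### Prime ideals of Heyting algebras -/

open Order in
-- The filter generated by `a` and the complement of `J` misses `b`: `c ⊓ a ≤ b` with `c ∉ J` would
-- give `c ≤ a ⇨ b ∈ J`. The prime ideal theorem separates it from `b`.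
theorem exists_isPrime_of_himp_mem {H : Type u} [HeytingAlgebra H] {J : Ideal H}
    (hJ : J.IsPrime) {a b : H} (h : a ⇨ b ∈ J) :
    ∃ J' : Ideal H, J'.IsPrime ∧ J' ≤ J ∧ a ∉ J' ∧ b ∈ J' := by
  have hF : IsPFilter {z : H | ∃ c, c ∉ J ∧ c ⊓ a ≤ z} := by
    refine IsPFilter.of_def ⟨⊤, ⊤, hJ.top_notMem, le_top⟩ ?_ ?_
    · rintro x ⟨c, hc, hx⟩ y ⟨d, hd, hy⟩
      refine ⟨x ⊓ y, ⟨c ⊓ d, fun hcd => (hJ.mem_or_mem hcd).elim hc hd, ?_⟩, inf_le_left,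
        inf_le_right⟩
      exact le_inf ((inf_le_inf_right a inf_le_left).trans hx)
        ((inf_le_inf_right a inf_le_right).trans hy)
    · rintro x y hxy ⟨c, hc, hx⟩
      exact ⟨c, hc, hx.trans hxy⟩
  have hdisj : Disjoint (hF.toPFilter : Set H) (Ideal.principal b : Set H) := by
    rw [Set.disjoint_left]
    rintro z ⟨c, hc, hz⟩ hb
    exact hc (J.lower (le_himp_iff.2 (hz.trans (Ideal.mem_principal.1 hb))) h)
  obtain ⟨J', hprime, hb, hd⟩ := DistribLattice.prime_ideal_of_disjoint_filter_ideal hdisj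
  rw [Set.disjoint_left] at hd
  refine ⟨J', hprime, fun c hc => ?_, fun ha => ?_, hb (Ideal.mem_principal.2 le_rfl)⟩
  · by_contra hcJ
    exact hd (show c ∈ hF.toPFilter from ⟨c, hcJ, inf_le_left⟩) hc
  · exact hd (show a ∈ hF.toPFilter from ⟨⊤, hJ.top_notMem, inf_le_right⟩) ha

open Order in
theorem himp_notMem_iff {H : Type u} [HeytingAlgebra H] {J : Ideal H} (hJ : J.IsPrime) {a b : H} :
    a ⇨ b ∉ J ↔ ∀ J' : Ideal H, J'.IsPrime → J' ≤ J → a ∉ J' → b ∉ J' := by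
  refine ⟨fun h J' hJ' hle ha hb => ?_, fun h hab => ?_⟩
  · have : a ⊓ (a ⇨ b) ∈ J' := J'.lower inf_himp_le hb
    exact (hJ'.mem_or_mem this).elim ha fun h' => h (hle h')
  · obtain ⟨J', h1, h2, h3, h4⟩ := exists_isPrime_of_himp_mem hJ hab
    exact h J' h1 h2 h3 h4

open Order in
theorem eq_top_of_forall_isPrime_notMem {H : Type u} [HeytingAlgebra H] {a : H}
    (h : ∀ J : Ideal H, J.IsPrime → a ∉ J) : a = ⊤ := by
  by_contra ha
  have hdisj : Disjoint (PFilter.principal (⊤ : H) : Set H) (Ideal.principal a : Set H) := by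
    rw [Set.disjoint_left]
    intro z hz hz'
    exact ha (top_le_iff.1 ((PFilter.mem_principal.1 hz).trans (Ideal.mem_principal.1 hz')))
  obtain ⟨J, hJ, haJ, -⟩ := DistribLattice.prime_ideal_of_disjoint_filter_ideal hdisj
  exact h J hJ (haJ (Ideal.mem_principal.2 le_rfl))

/-! ### The Rieger–Nishimura ladder -/

namespace RNLadder

theorem mem_himp {U V : RNLadder} {w : RNPoint} : w ∈ U ⇨ V ↔ ∀ v ≤ w, v ∈ U → v ∈ V := by
  rw [← LowerSet.Iic_le, le_himp_iff]
  exact ⟨fun h v hv hU => h ⟨hv, hU⟩, fun h v hv => h v hv.1 hv.2⟩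

theorem mem_compl {U : RNLadder} {w : RNPoint} : w ∈ (Uᶜ : RNLadder) ↔ ∀ v ≤ w, v ∉ U := by
  rw [← himp_bot, mem_himp]
  exact Iff.rfl

end RNLadder

theorem RNPoint.le_iff {v w : RNPoint} : v ≤ w ↔ v.idx = w.idx ∨ v.idx + 2 ≤ w.idx := Iff.rfl

namespace RNLadder

theorem mem_gen {w : RNPoint} : w ∈ gen ↔ w.idx = 0 := by
  rw [gen, LowerSet.mem_Iic_iff, RNPoint.le_iff]
  simp

theorem mem_of_idx_add_two_le {U : RNLadder} {m n : ℕ} (hn : (⟨n⟩ : RNPoint) ∈ U)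
    (h : m = n ∨ m + 2 ≤ n) : (⟨m⟩ : RNPoint) ∈ U :=
  U.lower h hn

theorem ext_idx {U V : RNLadder} (h : ∀ n, (⟨n⟩ : RNPoint) ∈ U ↔ (⟨n⟩ : RNPoint) ∈ V) : U = V :=
  LowerSet.ext (Set.ext fun w => h w.idx)

/-- A proper element of the ladder is bounded. -/
theorem idx_lt_of_notMem {U : RNLadder} {m n : ℕ} (hm : (⟨m⟩ : RNPoint) ∉ U)
    (hn : (⟨n⟩ : RNPoint) ∈ U) : n < m + 2 := by
  by_contra h
  exact hm (mem_of_idx_add_two_le hn (Or.inr (by omega)))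

theorem eq_top_or_exists_notMem (U : RNLadder) : U = ⊤ ∨ ∃ m, (⟨m⟩ : RNPoint) ∉ U := by
  by_contra! h
  exact h.1 (ext_idx fun n => iff_of_true (h.2 n) trivial)

/-- The disjunction property: proper elements are bounded, so two of them miss a common point far
out. -/
theorem eq_top_of_sup_eq_top {U V : RNLadder} (h : U ⊔ V = ⊤) : U = ⊤ ∨ V = ⊤ := by
  rcases eq_top_or_exists_notMem U with hU | ⟨m, hm⟩
  · exact Or.inl hU
  rcases eq_top_or_exists_notMem V with hV | ⟨n, hn⟩
  · exact Or.inr hV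
  have : (⟨m + n + 2⟩ : RNPoint) ∈ U ⊔ V := by rw [h]; trivial
  rcases this with hU | hV
  · have := idx_lt_of_notMem hm hU
    omega
  · have := idx_lt_of_notMem hn hV
    omega

theorem gen_ne_top : gen ≠ ⊤ := fun h => by
  have : (⟨1⟩ : RNPoint) ∈ gen := by rw [h]; trivial
  rw [mem_gen] at this
  exact one_ne_zero this

theorem bot_ne_top : (⊥ : RNLadder) ≠ ⊤ := fun h => by
  have : (⟨0⟩ : RNPoint) ∈ (⊥ : RNLadder) := by rw [h]; trivial
  exact this

instance : Nontrivial RNLadder := ⟨⟨⊥, ⊤, bot_ne_top⟩⟩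

/-- The proper ladder element `{w₀, …, wₙ₋₁}`. -/
def initial (n : ℕ) : RNLadder where
  carrier := {w | w.idx < n}
  lower' := by
    intro v w h hv
    rcases h with h | h <;> simp only [Set.mem_ofPred_eq] at * <;> omega

theorem initial_injective : Function.Injective initial := by
  intro m n h
  have key : ∀ k, k < m ↔ k < n := fun k => SetLike.ext_iff.1 h ⟨k⟩
  have h1 := key m
  have h2 := key n
  omega

end RNLadder

/-! ### Generation of the Rieger–Nishimura ladder -/

namespace RNLadder

theorem mem_initial {n : ℕ} {w : RNPoint} : w ∈ initial n ↔ w.idx < n := Iff.rfl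

theorem initial_zero : initial 0 = ⊥ :=
  ext_idx fun n => iff_of_false (Nat.not_lt_zero n) id

theorem initial_succ (n : ℕ) : initial (n + 1) = initial n ⊔ LowerSet.Iic ⟨n⟩ := by
  refine ext_idx fun k => ?_
  rw [LowerSet.mem_sup_iff, mem_initial, mem_initial, LowerSet.mem_Iic_iff, RNPoint.le_iff]
  dsimp only
  omega

/-- The points below `n + 1` are exactly those that do not see `n`, and `initial (n - 1)` is `Iic n`
without `n` itself (also for `n = 0`, where both are empty). -/
theorem Iic_succ (n : ℕ) :
    LowerSet.Iic (⟨n + 1⟩ : RNPoint) = LowerSet.Iic ⟨n⟩ ⇨ initial (n - 1) := by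
  refine ext_idx fun k => ?_
  rw [mem_himp, LowerSet.mem_Iic_iff, RNPoint.le_iff]
  dsimp only
  constructor
  · intro hk v hv hvn
    rw [LowerSet.mem_Iic_iff, RNPoint.le_iff] at hvn
    rw [RNPoint.le_iff] at hv
    rw [mem_initial]
    dsimp only at *
    omega
  · intro h
    by_contra hk
    have : (⟨n⟩ : RNPoint) ∈ initial (n - 1) :=
      h ⟨n⟩ (RNPoint.le_iff.2 (by dsimp only; omega)) (LowerSet.mem_Iic_iff.2 le_rfl)
    rw [mem_initial] at this
    dsimp only at this
    omega

/-- The elements of the ladder other than `⊤` are `{w₀, …, wₘ₋₁}` and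
`{w₀, …, wₘ₋₁, wₘ₊₁}`. -/
theorem eq_top_or_initial_or_Iic (U : RNLadder) :
    U = ⊤ ∨ ∃ m, U = initial m ∨ U = LowerSet.Iic ⟨m + 1⟩ := by
  classical
  rcases eq_top_or_exists_notMem U with hU | hU
  · exact Or.inl hU
  refine Or.inr ⟨Nat.find hU, ?_⟩
  have hm := Nat.find_spec hU
  have hlt : ∀ k < Nat.find hU, (⟨k⟩ : RNPoint) ∈ U := fun k hk => not_not.1 (Nat.find_min hU hk)
  generalize Nat.find hU = m at hm hlt
  by_cases h : (⟨m + 1⟩ : RNPoint) ∈ U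
  · right
    refine ext_idx fun k => ?_
    rw [LowerSet.mem_Iic_iff, RNPoint.le_iff]
    dsimp only
    refine ⟨fun hk => ?_, fun hk => mem_of_idx_add_two_le h hk⟩
    have := idx_lt_of_notMem hm hk
    have : k ≠ m := by rintro rfl; exact hm hk
    omega
  · left
    refine ext_idx fun k => ⟨fun hk => ?_, fun hk => hlt k hk⟩
    have := idx_lt_of_notMem hm hk
    have : k ≠ m := by rintro rfl; exact hm hk
    have : k ≠ m + 1 := by rintro rfl; exact h hk
    rw [mem_initial]
    dsimp only
    omega

/-- A subset of the ladder that contains `g` and the bounds and is closed under joins and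
implications is the whole ladder. -/
theorem mem_of_closed {S : Set RNLadder} (hg : gen ∈ S) (hbot : ⊥ ∈ S) (htop : ⊤ ∈ S)
    (hsup : ∀ x ∈ S, ∀ y ∈ S, x ⊔ y ∈ S) (himp : ∀ x ∈ S, ∀ y ∈ S, x ⇨ y ∈ S) (U : RNLadder) :
    U ∈ S := by
  have key : ∀ n, LowerSet.Iic (⟨n⟩ : RNPoint) ∈ S ∧ initial (n - 1) ∈ S ∧ initial n ∈ S := by
    intro n
    induction n with
    | zero => exact ⟨hg, initial_zero ▸ hbot, initial_zero ▸ hbot⟩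
    | succ n ih =>
      obtain ⟨h1, h2, h3⟩ := ih
      exact ⟨Iic_succ n ▸ himp _ h1 _ h2, h3, initial_succ n ▸ hsup _ h3 _ h1⟩
  rcases eq_top_or_initial_or_Iic U with h | ⟨m, h | h⟩
  · exact h ▸ htop
  · exact h ▸ (key m).2.2
  · exact h ▸ (key (m + 1)).1

end RNLadder

/-! ### Freeness of the Rieger–Nishimura ladder -/

/-- The elements `dₙ` of a Heyting algebra that correspond to the principal elements of the
Rieger–Nishimura ladder when `x` corresponds to the generator, each together with
`⨆ k < n - 1, dₖ` and `⨆ k < n, dₖ`. -/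
def nishimura {H : Type u} [HeytingAlgebra H] (x : H) : ℕ → H × H × H
  | 0 => (x, ⊥, ⊥)
  | n + 1 => ((nishimura x n).1 ⇨ (nishimura x n).2.1, (nishimura x n).2.2,
      (nishimura x n).2.2 ⊔ (nishimura x n).1)

section Freeness

open Order

variable {H : Type u} [HeytingAlgebra H] {x : H} {J : Ideal H}

theorem nishimura_join_notMem_iff (n : ℕ) :
    ((nishimura x n).2.2 ∉ J ↔ ∃ k < n, (nishimura x k).1 ∉ J) ∧
    ((nishimura x n).2.1 ∉ J ↔ ∃ k, k + 2 ≤ n ∧ (nishimura x k).1 ∉ J) := by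
  induction n with
  | zero => simp [nishimura]
  | succ n ih =>
    refine ⟨?_, ?_⟩
    · simp only [nishimura, Ideal.sup_mem_iff, not_and_or, ih.1]
      constructor
      · rintro (⟨k, hk, h⟩ | h)
        · exact ⟨k, by omega, h⟩
        · exact ⟨n, by omega, h⟩
      · rintro ⟨k, hk, h⟩
        rcases Nat.lt_succ_iff_lt_or_eq.1 hk with hk | rfl
        · exact Or.inl ⟨k, hk, h⟩
        · exact Or.inr h
    · simp only [nishimura, ih.1]
      exact exists_congr fun k => and_congr_left fun _ => by omega

theorem nishimura_succ_notMem_iff (hJ : J.IsPrime) (n : ℕ) :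
    (nishimura x (n + 1)).1 ∉ J ↔ ∀ J' : Ideal H, J'.IsPrime → J' ≤ J → (nishimura x n).1 ∉ J' →
      ∃ k, k + 2 ≤ n ∧ (nishimura x k).1 ∉ J' := by
  rw [nishimura, himp_notMem_iff hJ]
  exact forall_congr' fun J' => forall_congr' fun _ => by
    rw [(nishimura_join_notMem_iff n).2]

/-- The set of `n` with `dₙ` outside a given prime ideal is empty or of the form
`{n | wₘ ≤ wₙ}`. -/
theorem nishimura_notMem_cases (hJ : J.IsPrime) :
    (∀ n, (nishimura x n).1 ∈ J) ∨
      ∃ m, ∀ n, (nishimura x n).1 ∉ J ↔ (⟨m⟩ : RNPoint) ≤ ⟨n⟩ := by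
  classical
  by_cases h : ∃ n, (nishimura x n).1 ∉ J
  swap
  · left
    simpa using h
  right
  refine ⟨Nat.find h, fun n => ?_⟩
  have hm := Nat.find_spec h
  have hlt : ∀ k < Nat.find h, (nishimura x k).1 ∈ J := fun k hk => not_not.1 (Nat.find_min h hk)
  generalize Nat.find h = m at hm hlt
  rw [RNPoint.le_iff]
  dsimp only
  constructor
  · intro hn
    by_contra hmn
    rcases Nat.lt_or_ge n m with hnm | hnm
    · exact hn (hlt n hnm)
    · obtain rfl : n = m + 1 := by omega
      -- If dₘ and dₘ₊₁ both held at `J`, so would some dₖ with `k + 2 ≤ m`, against minimality.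
      obtain ⟨k, hk, hkJ⟩ := (nishimura_succ_notMem_iff hJ m).1 hn J hJ le_rfl hm
      exact hkJ (hlt k (by omega))
  · rintro (rfl | hmn)
    · exact hm
    · obtain ⟨n, rfl⟩ : ∃ k, n = k + 1 := ⟨n - 1, by omega⟩
      rw [nishimura_succ_notMem_iff hJ]
      intro J' hJ' hle hn
      rcases Nat.eq_or_lt_of_le (show m + 1 ≤ n by omega) with rfl | hlt'
      · obtain ⟨k, hk, hkJ⟩ :=
          (nishimura_succ_notMem_iff hJ' m).1 hn J' hJ' le_rfl fun h => hm (hle h)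
        exact ⟨k, by omega, hkJ⟩
      · exact ⟨m, by omega, fun h => hm (hle h)⟩

/-- The ladder element `U` holds at the prime ideal `J` when `x` is taken for the generator. -/
def LadderHolds (x : H) (J : Ideal H) (U : RNLadder) : Prop :=
  U = ⊤ ∨ ∃ n, (⟨n⟩ : RNPoint) ∈ U ∧ (nishimura x n).1 ∉ J

theorem ladderHolds_gen : LadderHolds x J RNLadder.gen ↔ x ∉ J := by
  constructor
  · rintro (h | ⟨n, hn, h⟩)
    · exact absurd h RNLadder.gen_ne_top
    · obtain rfl : n = 0 := RNLadder.mem_gen.1 hn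
      exact h
  · exact fun h => Or.inr ⟨0, RNLadder.mem_gen.2 rfl, h⟩

theorem not_ladderHolds_bot : ¬ LadderHolds x J ⊥ := by
  rintro (h | ⟨n, hn, -⟩)
  · exact RNLadder.bot_ne_top h
  · exact hn

/-- A prime ideal behaves like a point wₘ or like a point at infinity where only `⊤` holds. The
latter is why `LadderHolds` treats `⊤` separately. -/
theorem ladderHolds_cases (x : H) (hJ : J.IsPrime) :
    ((∀ n, (nishimura x n).1 ∈ J) ∧ ∀ U, LadderHolds x J U ↔ U = ⊤) ∨
      ∃ m : ℕ, (∀ n, (nishimura x n).1 ∉ J ↔ (⟨m⟩ : RNPoint) ≤ ⟨n⟩) ∧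
        ∀ U, LadderHolds x J U ↔ (⟨m⟩ : RNPoint) ∈ U := by
  rcases nishimura_notMem_cases (x := x) hJ with h | ⟨m, h⟩
  · exact Or.inl ⟨h, fun U => ⟨fun hU => hU.resolve_right fun ⟨n, _, hn⟩ => hn (h n), Or.inl⟩⟩
  · refine Or.inr ⟨m, h, fun U => ⟨?_, fun hU => Or.inr ⟨m, hU, (h m).2 le_rfl⟩⟩⟩
    rintro (rfl | ⟨n, hn, hnJ⟩)
    · trivial
    · exact U.lower ((h n).1 hnJ) hn

theorem ladderHolds_inf (hJ : J.IsPrime) (U V : RNLadder) :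
    LadderHolds x J (U ⊓ V) ↔ LadderHolds x J U ∧ LadderHolds x J V := by
  rcases ladderHolds_cases x hJ with ⟨-, h⟩ | ⟨m, -, h⟩
  · rw [h, h, h, inf_eq_top_iff]
  · rw [h, h, h, LowerSet.mem_inf_iff]

theorem ladderHolds_sup (hJ : J.IsPrime) (U V : RNLadder) :
    LadderHolds x J (U ⊔ V) ↔ LadderHolds x J U ∨ LadderHolds x J V := by
  rcases ladderHolds_cases x hJ with ⟨-, h⟩ | ⟨m, -, h⟩
  · rw [h, h, h]
    -- At the point at infinity this is the disjunction property.
    refine ⟨RNLadder.eq_top_of_sup_eq_top, ?_⟩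
    rintro (rfl | rfl) <;> simp
  · rw [h, h, h, LowerSet.mem_sup_iff]

theorem ladderHolds_mono {J' : Ideal H} (hle : J' ≤ J) {U : RNLadder} (h : LadderHolds x J U) :
    LadderHolds x J' U :=
  h.imp_right fun ⟨n, hn, hnJ⟩ => ⟨n, hn, fun h => hnJ (hle h)⟩

theorem ladderHolds_himp (hJ : J.IsPrime) (U V : RNLadder) :
    LadderHolds x J (U ⇨ V) ↔ ∀ J' : Ideal H, J'.IsPrime → J' ≤ J → LadderHolds x J' U →
      LadderHolds x J' V := by
  constructor
  · intro h J' hJ' hle hU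
    have := (ladderHolds_inf hJ' U (U ⇨ V)).2 ⟨hU, ladderHolds_mono hle h⟩
    rw [inf_himp, ladderHolds_inf hJ'] at this
    exact this.2
  · intro h
    -- If dₘ₊₁ fails at `J`, some prime ideal `J' ≤ J` behaves exactly like wₘ: dₘ holds there, but
    -- no dₖ with `k + 2 ≤ m`. So every point properly below the type of `J` is realized below `J`.
    have key : ∀ m, (nishimura x (m + 1)).1 ∈ J → (⟨m⟩ : RNPoint) ∈ U → (⟨m⟩ : RNPoint) ∈ V := by
      intro m hm hU
      have := (nishimura_succ_notMem_iff hJ m).not_right.1 hm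
      push Not at this
      obtain ⟨J', hJ', hle, hmJ, hk⟩ := this
      have hV := h J' hJ' hle (Or.inr ⟨m, hU, hmJ⟩)
      rcases ladderHolds_cases x hJ' with ⟨h', -⟩ | ⟨k, h1, h2⟩
      · exact absurd (h' m) hmJ
      · rw [h2] at hV
        rcases RNPoint.le_iff.1 ((h1 m).1 hmJ) with hkm | hkm
        · obtain rfl : k = m := hkm
          exact hV
        · exact absurd (hk k hkm) ((h1 k).2 le_rfl)
    rcases ladderHolds_cases x hJ with ⟨h1, h2⟩ | ⟨m, h1, h2⟩
    · rw [h2, himp_eq_top_iff]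
      exact fun w hw => key w.idx (h1 _) hw
    · rw [h2, RNLadder.mem_himp]
      intro v hv hU
      rcases RNPoint.le_iff.1 hv with hvm | hvm
      · obtain rfl : v = ⟨m⟩ := RNPoint.ext hvm
        exact (h2 V).1 (h J hJ le_rfl ((h2 U).2 hU))
      · refine key v.idx ?_ hU
        by_contra hv'
        have := RNPoint.le_iff.1 ((h1 _).1 hv')
        dsimp only at this hvm
        omega

theorem Formula.ladderHolds_eval (hJ : J.IsPrime) (χ : Formula (Fin 2)) :
    LadderHolds x J (χ.eval ![RNLadder.gen, ⊥]) ↔ χ.eval ![x, ⊥] ∉ J := by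
  induction χ generalizing J with
  | var i =>
    fin_cases i
    · exact ladderHolds_gen
    · exact iff_of_false not_ladderHolds_bot fun h => h J.bot_mem
  | and φ ψ hφ hψ =>
    rw [Formula.eval, Formula.eval, ladderHolds_inf hJ, hφ hJ, hψ hJ, ← not_or]
    exact not_congr ⟨fun h => h.elim (J.lower inf_le_left) (J.lower inf_le_right), hJ.mem_or_mem⟩
  | or φ ψ hφ hψ =>
    rw [Formula.eval, Formula.eval, ladderHolds_sup hJ, hφ hJ, hψ hJ, Ideal.sup_mem_iff,
      not_and_or]
  | imp φ ψ hφ hψ =>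
    rw [Formula.eval, Formula.eval, ladderHolds_himp hJ, himp_notMem_iff hJ]
    exact forall_congr' fun J' => forall_congr' fun h => by rw [hφ h, hψ h]
  | neg φ hφ =>
    rw [Formula.eval, Formula.eval, ← himp_bot, ← himp_bot, ladderHolds_himp hJ,
      himp_notMem_iff hJ]
    exact forall_congr' fun J' => forall_congr' fun h => by
      rw [hφ h]
      simp [not_ladderHolds_bot]

end Freeness

/-- An identity that holds for the generator of the Rieger–Nishimura ladder holds for every element
of every Heyting algebra. -/
theorem Formula.eval_eq_top_of_gen {H : Type u} [HeytingAlgebra H] {χ : Formula (Fin 2)}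
    (h : χ.eval ![RNLadder.gen, ⊥] = ⊤) (x : H) : χ.eval ![x, ⊥] = ⊤ :=
  eq_top_of_forall_isPrime_notMem fun _ hJ => (χ.ladderHolds_eval hJ).1 (Or.inl h)

/-! ### The defining formula in the ladder -/

/-- The operation `x¹⁰`. -/
def heytingPow10 {H : Type u} [HeytingAlgebra H] (x : H) : H :=
  (xᶜᶜ ⇨ x) ⊔ ((xᶜᶜ ⇨ x) ⇨ (x ⊔ xᶜ))

theorem definingFormula_eval {H : Type u} [HeytingAlgebra H] (p q : H) :
    definingFormula.eval ![p, q] =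
      (p ⊓ q)ᶜ ⊓ ((qᶜᶜ ⇨ q) ⊓ (heytingPow10 p ⇨ (q ⊔ qᶜ))) := rfl

namespace RNLadder

theorem eq_zero_or_two {w : RNPoint} (h : ¬ (⟨1⟩ : RNPoint) ≤ w) : w = ⟨0⟩ ∨ w = ⟨2⟩ := by
  rw [RNPoint.le_iff] at h
  simp only [RNPoint.ext_iff]
  dsimp only at h
  omega

theorem eq_one {w : RNPoint} (h : ¬ (⟨0⟩ : RNPoint) ≤ w) : w = ⟨1⟩ := by
  rw [RNPoint.le_iff] at h
  simp only [RNPoint.ext_iff]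
  dsimp only at h
  omega

theorem zero_le_or_one_le (w : RNPoint) : (⟨0⟩ : RNPoint) ≤ w ∨ (⟨1⟩ : RNPoint) ≤ w := by
  simp only [RNPoint.le_iff]
  omega

theorem le_zero {v : RNPoint} (h : v ≤ ⟨0⟩) : v = ⟨0⟩ := by
  rw [RNPoint.le_iff] at h
  simp only [RNPoint.ext_iff]
  dsimp only at h ⊢
  omega

theorem le_one {v : RNPoint} (h : v ≤ ⟨1⟩) : v = ⟨1⟩ := by
  rw [RNPoint.le_iff] at h
  simp only [RNPoint.ext_iff]
  dsimp only at h ⊢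
  omega

/-- Only the two end points matter for the double negation. -/
theorem mem_compl_compl {U : RNLadder} {w : RNPoint} :
    w ∈ (Uᶜᶜ : RNLadder) ↔ ((⟨0⟩ : RNPoint) ≤ w → (⟨0⟩ : RNPoint) ∈ U) ∧
      ((⟨1⟩ : RNPoint) ≤ w → (⟨1⟩ : RNPoint) ∈ U) := by
  simp only [mem_compl]
  constructor
  · intro h
    refine ⟨fun hw => ?_, fun hw => ?_⟩
    · by_contra h0
      exact h _ hw fun v hv => le_zero hv ▸ h0
    · by_contra h1
      exact h _ hw fun v hv => le_one hv ▸ h1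
  · rintro ⟨h0, h1⟩ v hv h
    rcases zero_le_or_one_le v with hv' | hv'
    · exact h _ hv' (h0 (hv'.trans hv))
    · exact h _ hv' (h1 (hv'.trans hv))

theorem mem_compl_iff {U : RNLadder} {w : RNPoint} :
    w ∈ (Uᶜ : RNLadder) ↔ ((⟨0⟩ : RNPoint) ≤ w → (⟨0⟩ : RNPoint) ∉ U) ∧
      ((⟨1⟩ : RNPoint) ≤ w → (⟨1⟩ : RNPoint) ∉ U) := by
  rw [mem_compl]
  refine ⟨fun h => ⟨h _, h _⟩, ?_⟩
  rintro ⟨h0, h1⟩ v hv hU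
  rcases zero_le_or_one_le v with hv' | hv'
  · exact h0 (hv'.trans hv) (U.lower hv' hU)
  · exact h1 (hv'.trans hv) (U.lower hv' hU)

/-- A point at which `x¹⁰` fails. -/
theorem of_notMem_pow10 {U : RNLadder} {w : RNPoint} (h : w ∉ heytingPow10 U) :
    (∃ v ≤ w, v ∈ (Uᶜᶜ : RNLadder) ∧ v ∉ U) ∧
      ∃ v ≤ w, v ∈ Uᶜᶜ ⇨ U ∧ v ∉ U ∧ v ∉ (Uᶜ : RNLadder) := by
  rw [heytingPow10, LowerSet.mem_sup_iff, not_or] at h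
  obtain ⟨h1, h2⟩ := h
  rw [mem_himp] at h1 h2
  push Not at h1 h2
  obtain ⟨v, hv, hvU, hv'⟩ := h2
  rw [LowerSet.mem_sup_iff, not_or] at hv'
  exact ⟨h1, v, hv, hvU, hv'⟩

theorem definingFormula_le (p q : RNLadder) : definingFormula.eval ![p, q] ≤ q ⊔ qᶜ := by
  rw [definingFormula_eval]
  rintro w ⟨hpq, hq, hpow⟩
  change w ∈ ((p ⊓ q)ᶜ : RNLadder) at hpq
  change w ∈ qᶜᶜ ⇨ q at hq
  change w ∈ heytingPow10 p ⇨ (q ⊔ qᶜ) at hpow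
  change w ∈ q ⊔ qᶜ
  rw [mem_compl] at hpq
  rw [mem_himp] at hq hpow
  by_contra hw
  obtain ⟨⟨v, hv, hvp, hvp'⟩, v', hv', hvr, hvn, hvc⟩ :=
    of_notMem_pow10 fun h => hw (hpow w le_rfl h)
  rw [LowerSet.mem_sup_iff, not_or] at hw
  have hwq : w ∉ (qᶜᶜ : RNLadder) := fun h => hw.1 (hq w le_rfl h)
  have hv'q : v' ∈ (qᶜ : RNLadder) := by
    refine (hpow v' hv' (Or.inl hvr)).resolve_left fun h => hvc ?_
    rw [mem_compl]
    exact fun z hz hzp => hpq z (hz.trans hv') ⟨hzp, q.lower hz h⟩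
  have hpq0 : (⟨0⟩ : RNPoint) ≤ w → (⟨0⟩ : RNPoint) ∈ p → (⟨0⟩ : RNPoint) ∉ q :=
    fun h hp hq => hpq _ h ⟨hp, hq⟩
  have hpq1 : (⟨1⟩ : RNPoint) ≤ w → (⟨1⟩ : RNPoint) ∈ p → (⟨1⟩ : RNPoint) ∉ q :=
    fun h hp hq => hpq _ h ⟨hp, hq⟩
  have hwc := hw.2
  rw [mem_himp] at hvr
  have hvr' := hvr v' le_rfl
  rw [mem_compl_compl] at hwq hvp hvr'
  rw [mem_compl_iff] at hwc hvc hv'q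
  have t0 : (⟨0⟩ : RNPoint) ≤ v → (⟨0⟩ : RNPoint) ≤ w := fun h => h.trans hv
  have t1 : (⟨1⟩ : RNPoint) ≤ v → (⟨1⟩ : RNPoint) ≤ w := fun h => h.trans hv
  have t0' : (⟨0⟩ : RNPoint) ≤ v' → (⟨0⟩ : RNPoint) ≤ w := fun h => h.trans hv'
  have t1' : (⟨1⟩ : RNPoint) ≤ v' → (⟨1⟩ : RNPoint) ≤ w := fun h => h.trans hv'
  have e1 : ¬ (⟨0⟩ : RNPoint) ≤ v → (⟨1⟩ : RNPoint) ∉ p := by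
    intro h hp
    rw [eq_one h] at hvp'
    exact hvp' hp
  have z := zero_le_or_one_le v
  -- The rest is propositional in the values at the end points w₀, w₁. From `v' ∉ pᶜ` and `v' ∉
  -- pᶜᶜ`, `v'` sees both ends; as `v' ∈ qᶜ`, `q` fails at both, against `w ∉ qᶜ`.
  grind only

theorem eq_gen_of_pow10_ne_top {y : RNLadder} (h : heytingPow10 y ≠ ⊤) : y = gen := by
  obtain ⟨n, hn⟩ := (eq_top_or_exists_notMem _).resolve_left h
  obtain ⟨⟨v, -, hv, hvy⟩, v', -, hvr, hvn, hvc⟩ := of_notMem_pow10 hn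
  have hvr' := mem_himp.1 hvr v' le_rfl
  rw [mem_compl_compl] at hv hvr'
  rw [mem_compl_iff] at hvc
  have e1 : ¬ (⟨0⟩ : RNPoint) ≤ v → (⟨1⟩ : RNPoint) ∉ y := by
    intro h hp
    rw [eq_one h] at hvy
    exact hvy hp
  have z := zero_le_or_one_le v
  -- `v'` sees one end inside `y` and one outside. If w₁ were the one inside, `v` could not see w₀,
  -- so `v` would be w₁, which contradicts `v ∉ y`.
  have h0 : (⟨0⟩ : RNPoint) ∈ y := by tauto
  have h1 : (⟨1⟩ : RNPoint) ∉ y := by tauto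
  have h2 : (⟨2⟩ : RNPoint) ∉ y := by
    intro h2
    rcases eq_zero_or_two (fun h => h1 (hv.2 h)) with rfl | rfl
    · exact hvy h0
    · exact hvy h2
  refine ext_idx fun k => ?_
  rw [mem_gen]
  refine ⟨fun hk => ?_, fun hk => ?_⟩
  · rcases eq_zero_or_two (fun h => h1 (y.lower h hk)) with h | h
    · exact congrArg RNPoint.idx h
    · exact absurd (h ▸ hk) h2
  · obtain rfl : k = 0 := hk
    exact h0

/-- The generator does not satisfy `g¹⁰ = 1`. -/
theorem pow10_gen_ne_top : heytingPow10 gen ≠ ⊤ := by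
  intro h
  -- The point w₂ refutes the first disjunct, w₃ the second.
  rcases eq_top_of_sup_eq_top h with h | h
  · have h2 : (⟨2⟩ : RNPoint) ∈ genᶜᶜ ⇨ gen := by rw [h]; trivial
    have := mem_himp.1 h2 _ le_rfl
    simp [mem_compl_compl, mem_gen, RNPoint.le_iff] at this
  · have h3 : (⟨3⟩ : RNPoint) ∈ (genᶜᶜ ⇨ gen) ⇨ (gen ⊔ genᶜ) := by rw [h]; trivial
    have := mem_himp.1 h3 _ le_rfl
    rw [mem_himp] at this
    simp only [mem_compl_compl, LowerSet.mem_sup_iff] at this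
    rw [mem_compl_iff] at this
    simp only [mem_gen, RNPoint.le_iff] at this
    have := this fun v hv h => by omega
    simp at this

end RNLadder

/-! ### Homomorphisms -/

/-- The homomorphism from the two-element Boolean algebra to a Heyting algebra. -/
def boolHeytingHom (H : Type u) [HeytingAlgebra H] : HeytingHom Bool H where
  toFun b := bif b then ⊤ else ⊥
  map_sup' x y := by cases x <;> cases y <;> simp
  map_inf' x y := by cases x <;> cases y <;> simp
  map_bot' := rfl
  map_himp' x y := by cases x <;> cases y <;> simp [himp_eq]

theorem boolHeytingHom_injective (H : Type u) [HeytingAlgebra H] [Nontrivial H] :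
    Function.Injective (boolHeytingHom H) := by
  intro x y h
  cases x <;> cases y
  · rfl
  · exact absurd h (bot_ne_top (α := H))
  · exact absurd h (top_ne_bot (α := H))
  · rfl

/-- The first projection of a product of Heyting algebras. -/
def prodFstHeytingHom (A : Type u) (B : Type v) [HeytingAlgebra A] [HeytingAlgebra B] :
    HeytingHom (A × B) A where
  toFun := Prod.fst
  map_sup' _ _ := rfl
  map_inf' _ _ := rfl
  map_bot' := rfl
  map_himp' _ _ := rfl

/-- The second projection of a product of Heyting algebras. -/
def prodSndHeytingHom (A : Type u) (B : Type v) [HeytingAlgebra A] [HeytingAlgebra B] :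
    HeytingHom (A × B) B where
  toFun := Prod.snd
  map_sup' _ _ := rfl
  map_inf' _ _ := rfl
  map_bot' := rfl
  map_himp' _ _ := rfl

namespace Concat

section

variable {A : Type u} {B : Type v} [HeytingAlgebra A] [HeytingAlgebra B]

/-- The projection of a concatenation onto its lower part, which collapses the upper part. -/
noncomputable def fstHom (A : Type u) (B : Type v) [HeytingAlgebra A] [HeytingAlgebra B] :
    HeytingHom (Concat A B) A where
  toFun := Concat.fst
  map_sup' _ _ := rfl
  map_inf' _ _ := rfl
  map_bot' := rfl
  map_himp' _ _ := rfl

theorem fst_himp (x y : Concat A B) : (x ⇨ y).fst = x.fst ⇨ y.fst := rfl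

theorem fst_sup (x y : Concat A B) : (x ⊔ y).fst = x.fst ⊔ y.fst := rfl

theorem fst_compl (x : Concat A B) : (xᶜ).fst = (x.fst)ᶜ := map_compl (fstHom A B) x

theorem snd_eq_bot {x : Concat A B} (h : x.fst ≠ ⊤) : x.snd = ⊥ := x.glued.resolve_left h

theorem le_of_fst_le {x y : Concat A B} (h : x.fst ≠ ⊤) (hle : x.fst ≤ y.fst) : x ≤ y :=
  ⟨hle, (snd_eq_bot h).trans_le bot_le⟩

theorem eq_of_fst_eq {x y : Concat A B} (h : x.fst ≠ ⊤) (he : x.fst = y.fst) : x = y :=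
  (le_of_fst_le h he.le).antisymm (le_of_fst_le (he ▸ h) he.ge)

end

open Classical in
/-- A homomorphism of the upper parts extends to concatenations. -/
noncomputable def map {A B C : Type*} [HeytingAlgebra A] [HeytingAlgebra B] [HeytingAlgebra C]
    (f : HeytingHom B C) : HeytingHom (Concat A B) (Concat A C) where
  toFun x := ⟨x.fst, f x.snd, x.glued.imp_right fun h => by rw [h, map_bot]⟩
  map_sup' x y := Concat.ext rfl (map_sup f _ _)
  map_inf' x y := Concat.ext rfl (map_inf f _ _)
  map_bot' := Concat.ext rfl (map_bot f)
  map_himp' x y := by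
    refine Concat.ext rfl ?_
    change f (if x.fst ≤ y.fst then x.snd ⇨ y.snd else ⊥) =
      if x.fst ≤ y.fst then f x.snd ⇨ f y.snd else ⊥
    split_ifs
    · exact map_himp f _ _
    · exact map_bot f

theorem map_injective {A B C : Type*} [HeytingAlgebra A] [HeytingAlgebra B] [HeytingAlgebra C]
    {f : HeytingHom B C} (hf : Function.Injective f) :
    Function.Injective (map (A := A) f) := fun _ _ h =>
  Concat.ext (congrArg (fun z : Concat A C => z.fst) h)
    (hf (congrArg (fun z : Concat A C => z.snd) h))

/-- The least nontrivial congruence of `A + Z₂` identifies the two greatest elements. -/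
theorem subdirectlyIrreducible_bool (A : Type u) [HeytingAlgebra A] :
    SubdirectlyIrreducible (Concat A Bool) := by
  have hne : (inr false : Concat A Bool) ≠ inr true :=
    fun h => Bool.false_ne_true (congrArg Concat.snd h)
  refine ⟨⟨⟨_, _, hne⟩⟩, Setoid.ker Concat.fst, ⟨?_, ?_, ?_, ?_⟩, ?_, ?_⟩
  · exact fun a b c d h h' => congrArg₂ (· ⊓ ·) h h'
  · exact fun a b c d h h' => congrArg₂ (· ⊔ ·) h h'
  · exact fun a b c d h h' => congrArg₂ (· ⇨ ·) h h'
  · intro a b h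
    change (aᶜ).fst = (bᶜ).fst
    rw [fst_compl, fst_compl, show a.fst = b.fst from h]
  · intro h
    have h' : Setoid.ker (Concat.fst : Concat A Bool → A) (inr false) (inr true) := rfl
    rw [h] at h'
    exact hne h'
  · intro s hs hsne
    have hex : ∃ x y, s x y ∧ ¬ x ≤ y := by
      by_contra! h
      exact hsne (Setoid.ext fun x y => ⟨fun hxy => (h x y hxy).antisymm (h y x (s.symm hxy)),
        fun hxy => (show x = y from hxy) ▸ s.refl x⟩)
    obtain ⟨x, y, hxy, hle⟩ := hex
    -- `x ⇨ y` is congruent to `⊤` but different from it, hence below the coatom `inr false`, which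
    -- is therefore congruent to `⊤` too.
    have ht : s (x ⇨ y) ⊤ := himp_self (a := y) ▸ hs.himp _ _ _ _ hxy (s.refl y)
    have hle' : x ⇨ y ≤ inr false := by
      refine ⟨le_top, ?_⟩
      rcases (x ⇨ y).glued with h | h
      · by_contra hsnd
        refine hle (himp_eq_top_iff.1 (Concat.ext h ?_))
        exact (Bool.eq_false_or_eq_true _).resolve_right fun h' => hsnd h'.le
      · exact h.le
    have hc : s (inr false) ⊤ := by
      have := hs.sup _ _ _ _ ht (s.refl (inr false))
      rwa [sup_eq_right.2 hle', top_sup_eq] at this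
    have key : ∀ z, s (z ⊓ inr false) z := fun z => by
      have := hs.inf _ _ _ _ (s.refl z) hc
      rwa [inf_top_eq] at this
    intro z w hzw
    have : z ⊓ inr false = w ⊓ inr false :=
      Concat.ext (congrArg (· ⊓ ⊤) hzw) ((inf_bot_eq z.snd).trans (inf_bot_eq w.snd).symm)
    exact s.trans (s.symm (key z)) (this ▸ key w)

end Concat

/-! ### The defining formula in `Z × Z₂ + A` -/

section

variable {ψ : Formula (Fin 2)}

theorem Formula.eval_gen_eq_top (h : ψ.eval ![ZPrime.a, ZPrime.b] = ⊤) :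
    ψ.eval ![RNLadder.gen, ⊥] = ⊤ := by
  have := ψ.eval_map_pair ((prodFstHeytingHom RNLadder Bool).comp (Concat.fstHom _ Bool))
    ZPrime.a ZPrime.b
  rw [h, map_top] at this
  exact this

theorem Formula.eval_bot_top_eq_top (h : ψ.eval ![ZPrime.a, ZPrime.b] = ⊤) (H : Type u)
    [HeytingAlgebra H] : ψ.eval ![(⊥ : H), ⊤] = ⊤ := by
  have := ψ.eval_map_pair ((boolHeytingHom H).comp
    ((prodSndHeytingHom RNLadder Bool).comp (Concat.fstHom _ Bool))) ZPrime.a ZPrime.b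
  rw [h, map_top] at this
  exact this

/-- Where `q` is decided, the defining formula implies every formula that holds in `Z'`. -/
theorem definingFormula_le_of_le {H : Type u} [HeytingAlgebra H]
    (h : ψ.eval ![ZPrime.a, ZPrime.b] = ⊤) {p q : H}
    (hle : definingFormula.eval ![p, q] ≤ q ⊔ qᶜ) :
    definingFormula.eval ![p, q] ≤ ψ.eval ![p, q] := by
  have hpq : definingFormula.eval ![p, q] ≤ (p ⊓ q)ᶜ := by
    rw [definingFormula_eval]
    exact inf_le_left
  generalize definingFormula.eval ![p, q] = e at hle hpq
  have hp : e ⊓ q ⊓ p = ⊥ := by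
    rw [inf_assoc, inf_comm q p, ← disjoint_iff]
    exact le_compl_iff_disjoint_right.1 hpq
  have h1 : e ⊓ q ≤ ψ.eval ![p, q] := by
    have := ψ.inf_eval_congr (c := e ⊓ q) (ν := ![p, q]) (μ := ![⊥, ⊤]) (by
      intro i
      fin_cases i
      · simpa using hp
      · simp)
    rw [ψ.eval_bot_top_eq_top h, inf_top_eq] at this
    exact inf_eq_left.1 this
  have h2 : e ⊓ qᶜ ≤ ψ.eval ![p, q] := by
    have := ψ.inf_eval_congr (c := e ⊓ qᶜ) (ν := ![p, q]) (μ := ![p, ⊥]) (by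
      intro i
      fin_cases i
      · rfl
      · simp [inf_assoc])
    rw [Formula.eval_eq_top_of_gen (Formula.eval_gen_eq_top h), inf_top_eq] at this
    exact inf_eq_left.1 this
  calc e = e ⊓ (q ⊔ qᶜ) := (inf_eq_left.2 hle).symm
    _ = e ⊓ q ⊔ e ⊓ qᶜ := inf_sup_left _ _ _
    _ ≤ _ := sup_le h1 h2

end

section

variable {A : Type u} [HeytingAlgebra A]

/-- Below the glued element only the ladder coordinate matters, since Z₂ is Boolean. -/
theorem Concat.compl_compl_le {x : Concat (RNLadder × Bool) A}
    (hx : x.fst ≠ ⊤) (h : x.fst.1ᶜᶜ ≤ x.fst.1) : xᶜᶜ ≤ x := by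
  have hle : (xᶜᶜ).fst ≤ x.fst := by
    rw [fst_compl, fst_compl]
    exact ⟨h, (_root_.compl_compl x.fst.2).le⟩
  exact le_of_fst_le (fun h => hx (top_le_iff.1 (h ▸ hle))) hle

/-- If the defining formula is not below `q ∨ ¬q`, then `p` and `q` are `(g, 0)` and `(0, 1)`. -/
theorem definingFormula_le_or_eq (p q : Concat (RNLadder × Bool) A) :
    definingFormula.eval ![p, q] ≤ q ⊔ qᶜ ∨
      p = Concat.inl (RNLadder.gen, false) ∧ q = Concat.inl (⊥, true) := by
  have hfst := definingFormula.eval_map_pair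
    ((prodFstHeytingHom RNLadder Bool).comp (Concat.fstHom _ A)) p q
  have hfst1 : (definingFormula.eval ![p, q]).fst.1 ≤ q.fst.1 ⊔ (q.fst.1)ᶜ :=
    hfst.symm.trans_le (RNLadder.definingFormula_le p.fst.1 q.fst.1)
  have hcompl : (q ⊔ qᶜ).fst = q.fst ⊔ (q.fst)ᶜ := by rw [Concat.fst_sup, Concat.fst_compl]
  by_cases hle : definingFormula.eval ![p, q] ≤ q ⊔ qᶜ
  · exact Or.inl hle
  right
  -- Otherwise the value lies strictly below the glued element, where the comparison is
  -- coordinatewise: `RNLadder.definingFormula_le` in Z, excluded middle in Z₂.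
  have he : (definingFormula.eval ![p, q]).fst = ⊤ := by
    by_contra he
    refine hle (Concat.le_of_fst_le he ?_)
    rw [hcompl]
    exact ⟨hfst1, le_top.trans (sup_compl_eq_top (x := q.fst.2)).ge⟩
  rw [he] at hfst1
  have hform := definingFormula_eval p q
  generalize definingFormula.eval ![p, q] = e at *
  have hpq : e ≤ (p ⊓ q)ᶜ := hform ▸ inf_le_left
  have hpow : heytingPow10 p ≠ ⊤ := by
    intro h
    rw [h, top_himp] at hform
    exact hle (hform ▸ inf_le_right.trans inf_le_right)
  have hdisj : p.fst ⊓ q.fst = ⊥ := by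
    have := hpq.1
    rw [he, Concat.fst_compl, le_compl_iff_disjoint_right, top_disjoint] at this
    exact this
  have hdisj1 : p.fst.1 ⊓ q.fst.1 = ⊥ := congrArg Prod.fst hdisj
  have hdisj2 : p.fst.2 ⊓ q.fst.2 = ⊥ := congrArg Prod.snd hdisj
  have hreg : p.fst ≠ ⊤ → ¬ (p.fst.1)ᶜᶜ ≤ p.fst.1 := fun hp h => by
    refine hpow ?_
    rw [heytingPow10, himp_eq_top_iff.2 (Concat.compl_compl_le hp h), top_sup_eq]
  rcases RNLadder.eq_top_of_sup_eq_top (top_le_iff.1 hfst1) with hq1 | hq1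
  · exfalso
    rw [hq1, inf_top_eq] at hdisj1
    refine hreg (fun h => ?_) (by simp [hdisj1])
    exact bot_ne_top (α := RNLadder) (hdisj1.symm.trans (congrArg Prod.fst h))
  rw [eq_top_iff, le_compl_iff_disjoint_right, top_disjoint] at hq1
  have hqtop : q.fst ≠ ⊤ := fun h =>
    bot_ne_top (α := RNLadder) (hq1.symm.trans (congrArg Prod.fst h))
  cases hq2 : q.fst.2 with
  | false =>
    exfalso
    have hq0 : q = ⊥ := Concat.eq_of_fst_eq hqtop (Prod.ext hq1 hq2)
    exact hle (by simp [hq0])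
  | true =>
    have hp2 : p.fst.2 = false := by
      rw [hq2] at hdisj2
      exact (Bool.and_true _).symm.trans hdisj2
    have hptop : p.fst ≠ ⊤ := fun h =>
      Bool.false_ne_true (hp2.symm.trans (congrArg Prod.snd h))
    refine ⟨Concat.eq_of_fst_eq hptop (Prod.ext ?_ hp2),
      Concat.eq_of_fst_eq hqtop (Prod.ext hq1 hq2)⟩
    -- If the ladder coordinate of `p` satisfied x¹⁰ = 1, one of the two disjuncts would be `⊤`
    -- there. Either one lifts to the concatenation and contradicts `hpow`.
    refine RNLadder.eq_gen_of_pow10_ne_top fun h => ?_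
    rcases RNLadder.eq_top_of_sup_eq_top h with h | h
    · exact hreg hptop (himp_eq_top_iff.1 h)
    · refine hpow ?_
      have hle' : pᶜᶜ ⇨ p ≤ p ⊔ pᶜ := by
        refine Concat.le_of_fst_le ?_ ?_
        · rw [Concat.fst_himp, Concat.fst_compl, Concat.fst_compl]
          exact fun h' => hreg hptop (himp_eq_top_iff.1 (congrArg Prod.fst h'))
        · rw [Concat.fst_himp, Concat.fst_sup, Concat.fst_compl, Concat.fst_compl]
          exact ⟨himp_eq_top_iff.1 h, le_top.trans (sup_compl_eq_top (x := p.fst.2)).ge⟩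
      rw [heytingPow10, himp_eq_top_iff.2 hle', sup_top_eq]

/-- Every formula that holds in `Z'` follows in `Z × Z₂ + A` from the defining formula. -/
theorem definingFormula_le_eval {ψ : Formula (Fin 2)} (h : ψ.eval ![ZPrime.a, ZPrime.b] = ⊤)
    (p q : Concat (RNLadder × Bool) A) :
    definingFormula.eval ![p, q] ≤ ψ.eval ![p, q] := by
  rcases definingFormula_le_or_eq p q with hle | ⟨rfl, rfl⟩
  · exact definingFormula_le_of_le h hle
  · have := ψ.eval_map_pair (Concat.map (A := RNLadder × Bool) (boolHeytingHom A))
      ZPrime.a ZPrime.b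
    rw [h, map_top] at this
    exact le_top.trans this.ge

end

/-! ### The algebra `Z'` -/

namespace ZPrime

theorem inl_initial_injective :
    Function.Injective fun n => (Concat.inl (RNLadder.initial n, false) : ZPrime) := fun _ _ h =>
  RNLadder.initial_injective (congrArg (fun x : ZPrime => x.fst.1) h)

theorem compl_b : bᶜ = Concat.inl (⊤, false) := by
  have h : (bᶜ).fst = (⊤, false) := by
    rw [Concat.fst_compl]
    exact Prod.ext compl_bot rfl
  refine Concat.eq_of_fst_eq ?_ h
  rw [h]
  exact fun h' => Bool.false_ne_true (congrArg Prod.snd h')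

/-- The set Z × {0} is not closed under implication, but it is the ideal below `bᶜ`; meeting with
`bᶜ` restores the implication of Z. -/
theorem inl_false_himp (x y : RNLadder) :
    (Concat.inl (x, false) ⇨ Concat.inl (y, false)) ⊓ bᶜ =
      (Concat.inl (x ⇨ y, false) : ZPrime) := by
  rw [compl_b]
  exact Concat.ext (Prod.ext (inf_top_eq _) (inf_bot_eq _)) (inf_bot_eq _)

theorem inf_a_b : a ⊓ b = ⊥ :=
  Concat.ext (Prod.ext (inf_bot_eq _) rfl) rfl

theorem generates : Generates ![a, b] := by
  intro S hS hinf hsup himp hcompl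
  have ha : a ∈ S := hS 0
  have hb : b ∈ S := hS 1
  have hZ : ∀ U : RNLadder, (Concat.inl (U, false) : ZPrime) ∈ S := by
    refine RNLadder.mem_of_closed (S := {U | (Concat.inl (U, false) : ZPrime) ∈ S}) ha
      (inf_a_b ▸ hinf _ ha _ hb :) (compl_b ▸ hcompl _ hb :) (fun x hx y hy => ?_)
      (fun x hx y hy => ?_)
    · have := hsup _ hx _ hy
      rwa [show (Concat.inl (x, false) ⊔ Concat.inl (y, false) : ZPrime) =
        Concat.inl (x ⊔ y, false) from Concat.ext rfl rfl] at this
    · exact (inl_false_himp x y ▸ hinf _ (himp _ hx _ hy) _ (hcompl _ hb) :)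
  have hinl : ∀ x : RNLadder × Bool, (Concat.inl x : ZPrime) ∈ S := by
    rintro ⟨U, i⟩
    cases i with
    | false => exact hZ U
    | true =>
      have := hsup _ (hZ U) _ hb
      exact (Concat.ext (Prod.ext (sup_bot_eq U) rfl) rfl :
        (Concat.inl (U, false) ⊔ b : ZPrime) = Concat.inl (U, true)) ▸ this
  refine Set.eq_univ_of_forall fun x => ?_
  cases h : x.snd with
  | false => exact (Concat.ext rfl h : x = Concat.inl x.fst) ▸ hinl x.fst
  | true =>
    -- Only the top of Z' lies outside the copy of Z × Z₂.
    have hx : x = ⊤ := Concat.ext (x.glued.resolve_right fun h' => by simp [h] at h') h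
    rw [hx, ← himp_self (a := a)]
    exact himp _ ha _ ha

theorem definingFormula_holds : definingFormula.eval ![a, b] = ⊤ := by
  have hb : b.fst ≠ ⊤ := fun h => bot_ne_top (α := RNLadder) (congrArg Prod.fst h)
  have hreg : bᶜᶜ ≤ b := Concat.compl_compl_le hb (by simp [b, Concat.inl])
  -- `b ⊔ bᶜ` is the glued element, and a¹⁰ stays strictly below it because g¹⁰ ≠ 1.
  have hpow : heytingPow10 a ≤ b ⊔ bᶜ := by
    refine Concat.le_of_fst_le (fun h => RNLadder.pow10_gen_ne_top ?_) ?_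
    · have h' := congrArg Prod.fst h
      simp only [heytingPow10, Concat.fst_sup, Concat.fst_himp, Concat.fst_compl] at h'
      exact h'
    · rw [compl_b]
      exact ⟨le_top.trans (bot_sup_eq _).ge, le_top⟩
  rw [definingFormula_eval, inf_a_b, compl_bot, himp_eq_top_iff.2 hreg, himp_eq_top_iff.2 hpow,
    inf_top_eq, inf_top_eq]

theorem definesOver (A : Type u) [HeytingAlgebra A] :
    DefinesOver (generatedVariety (Concat (RNLadder × Bool) A)) definingFormula ![a, b] where
  generates := generates
  holds := definingFormula_holds
  consequence ψ h := by
    refine validIn_generatedVariety fun μ => himp_eq_top_iff.2 ?_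
    have hμ : μ = ![μ 0, μ 1] := by
      funext i
      fin_cases i <;> rfl
    rw [hμ]
    exact definingFormula_le_eval h _ _

end ZPrime

/-! ### Membership in the variety -/

/-- A Heyting algebra lifted to a higher universe. -/
noncomputable abbrev uliftHeytingAlgebra (H : Type v) [HeytingAlgebra H] :
    HeytingAlgebra (ULift.{u} H) :=
  HeytingAlgebra.ofHImp (fun x y => ULift.up (x.down ⇨ y.down)) fun x y z =>
    le_himp_iff (a := x.down) (b := y.down) (c := z.down)

/-- A variety contains a copy of every algebra that embeds into one of its members. -/
theorem containsCopy_generatedVariety {A : Type u} {B : Type} [HeytingAlgebra A]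
    [HeytingAlgebra B] (f : HeytingHom B A) (hf : Function.Injective f) :
    ContainsCopy (generatedVariety A) B := by
  let := uliftHeytingAlgebra.{u} B
  refine ⟨ULift.{u} B, uliftHeytingAlgebra B, fun K hK hA => ?_, ⟨⟨Equiv.ulift.symm, Iff.rfl⟩⟩⟩
  let g : HeytingHom (ULift.{u} B) A :=
    { toFun := fun x => f x.down
      map_sup' := fun _ _ => map_sup f _ _
      map_inf' := fun _ _ => map_inf f _ _
      map_bot' := map_bot f
      map_himp' := fun _ _ => map_himp f _ _ }
  exact hK.subalgebra A (ULift.{u} B) g (fun _ _ h => ULift.down_injective (hf h)) hA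

theorem theorem4p1 (A : Type u) [HeytingAlgebra A] [Nontrivial A] :
    Infinite ZPrime ∧ SubdirectlyIrreducible ZPrime ∧
    ContainsCopy (generatedVariety (Concat (RNLadder × Bool) A)) ZPrime ∧
    DefinesOver (generatedVariety (Concat (RNLadder × Bool) A)) definingFormula
      ![ZPrime.a, ZPrime.b] ∧
    FinitelyPresentableOver (generatedVariety (Concat (RNLadder × Bool) A)) ZPrime :=
  ⟨Infinite.of_injective _ ZPrime.inl_initial_injective, Concat.subdirectlyIrreducible_bool _,
    containsCopy_generatedVariety _ (Concat.map_injective (boolHeytingHom_injective A)),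
    ZPrime.definesOver A, _, _, _, ZPrime.definesOver A⟩
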